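/- **Setting.** There are $n$ agents and $m$ divisible items with sizes $s\in\mathbb R_{>0}^m$ and capacity $c>0$. The set of feasible allocations is $\mathcal Z=\{z\in[0,1]^m:\ \|z\|_1\le 1,\ cz\le s\}$. Each agent $i$ has a utility $U_i:\mathcal Z\to[0,1]$ that is differentiable, strictly increasing, concave and $\beta$-smooth ($\|\nabla U_i(z)-\nabla U_i(z')\|_2\le\beta\|z-z'\|_2$ on $\mathcal Z$), with $U_i(0)=0$ and $U_i(z)>0$ for some $z\in\mathcal Z$. Let $L$ be a common Lipschitz constant of the utilities with respect to the $\ell_1$-norm: $|U_i(x)-U_i(y)|\le L\|x-y\|_1$ for all $x,y\in\mathcal Z$ and all $i$ (this holds in particular if every $U_i$ is $L$-Lipschitz for $\|\cdot\|_2$, and, with $L=1$, for linear utilities with coefficients in $[0,1]$). For $a,d\ge0$, an allocation $z\in\mathcal Z$ is an $(a,d)$-core outcome if there are no set $A$ of agents and $z'\in\mathcal Z$ with $\frac{|A|}{n}U_i(z')\ge(1+a)U_i(z)+d$ for all $i\in A$ and with strict inequality for at least one $i\in A$. **Algorithm (PPGA)** with parameters $K\in\mathbb N$, $\upsilon,\epsilon,\delta\in(0,1)$,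 $\alpha>1$, $\rho>0$. Put $\epsilon'=\frac1K\bigl(\epsilon-\frac{\log(1/\delta)}{\alpha-1}\bigr)$, $\sigma^2=\frac{\alpha}{n^2\epsilon'}$ and $q^{(0)}=z^{(0)}=\gamma_i^{(0)}=0$. For $k=1,\dots,K$: $$x_i^{(k)}=\operatorname*{argmax}_{x\in\mathcal Z}\Bigl(\log(U_i(x)+\upsilon)-(\gamma_i^{(k-1)})^T(x-z^{(k-1)})-\tfrac\rho2\|x-z^{(k-1)}\|_2^2\Bigr)\quad(1\le i\le n),$$ $$z^{(k)}=\tfrac1n\sum_i x_i^{(k)}+q^{(k)}-q^{(k-1)},\qquad \gamma_i^{(k)}=\gamma_i^{(k-1)}+\rho\,(x_i^{(k)}-z^{(k)})\quad(1\le i\le n),$$ where $q^{(1)},\dots,q^{(K)}$ are independent with law $\mathcal N(0,\sigma^2I_m)$. The output $\hat z$ is the Euclidean projection of $\frac1K\sum_{k=1}^K z^{(k)}$ onto $\mathcal Z$. **Statement.** Fix $\rho>0$, $\beta$, $L$, $\kappa$. Let $m=m(n)$, $K=K(n)$ and $\upsilon=\upsilon(n)$ satisfy $m=o(\sqrt n)$,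 $K=\Theta(n)$, $\upsilon=\Theta(1/\sqrt n)$ as $n\to\infty$, with $\upsilon(n)\in(0,1)$ for all large $n$. Then there are constants $C_1,C_2>0$ such that for all sufficiently large $n$, for all sizes $s$, capacities $c$ and utilities $U_1,\dots,U_n$ as above (with smoothness constant $\beta$ and Lipschitz constant $L$), and for all $\epsilon,\delta\in(0,1)$ with $\epsilon\le\kappa\log(1/\delta)$, PPGA run with $\alpha=2\log(1/\delta)/\epsilon+1$ returns, with probability at least $1-\frac1n-\frac1{n^m}$, an $(\varepsilon_1,\varepsilon_2(1+\varepsilon_1))$-core outcome, where $$\varepsilon_1=C_1\sqrt{\frac{m\log(1/\delta)}{n\epsilon^2}},\qquad \varepsilon_2=C_2\Bigl(\frac{m\log(1/\delta)}{n\epsilon^2}\Bigr)^{1/4}.$$ -/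

import Mathlib

open MeasureTheory ProbabilityTheory Filter Asymptotics
open scoped Topology

noncomputable section

namespace PPGA

/-- Allocation vectors `ℝ^m` with the Euclidean norm. -/
abbrev Vec (m : ℕ) : Type := EuclideanSpace ℝ (Fin m)

/-- The set of feasible allocations for item sizes `s` and total capacity `c`. -/
def feasible {m : ℕ} (s : Fin m → ℝ) (c : ℝ) : Set (Vec m) :=
  {z | (∀ j, z j ∈ Set.Icc (0 : ℝ) 1) ∧ ∑ j, |z j| ≤ 1 ∧ ∀ j, c * z j ≤ s j}

/-- The class of utility functions on a feasible set `Z`: differentiable, strictly increasing,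
concave, `β`-smooth, with values in `[0, 1]`, zero at the zero allocation, and not identically
zero. Only the values of `U` on `Z` matter. -/
structure IsUtility {m : ℕ} (Z : Set (Vec m)) (β : ℝ) (U : Vec m → ℝ) : Prop where
  differentiable : DifferentiableOn ℝ U Z
  strictly_increasing : ∀ x ∈ Z, ∀ y ∈ Z, (∀ j, x j ≤ y j) → x ≠ y → U x < U y
  concave : ConcaveOn ℝ Z U
  smooth : ∀ x ∈ Z, ∀ y ∈ Z, ‖gradientWithin U Z x - gradientWithin U Z y‖ ≤ β * ‖x - y‖
  mem_Icc : ∀ x ∈ Z, U x ∈ Set.Icc (0 : ℝ) 1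
  zero : U 0 = 0
  exists_pos : ∃ x ∈ Z, 0 < U x

/-- `z` is an `(a, d)`-core outcome for the agents' utilities `U` on the feasible set `Z`. -/
def IsApproxCore {n m : ℕ} (Z : Set (Vec m)) (U : Fin n → Vec m → ℝ) (a d : ℝ)
    (z : Vec m) : Prop :=
  z ∈ Z ∧ ¬ ∃ (A : Finset (Fin n)), ∃ z' ∈ Z,
    (∀ i ∈ A, (1 + a) * U i z + d ≤ ((A.card : ℝ) / n) * U i z') ∧
    ∃ i ∈ A, (1 + a) * U i z + d < ((A.card : ℝ) / n) * U i z'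

/-- A maximizer of `f` over `S` (an arbitrary vector if there is none). -/
def argmaxOn {m : ℕ} (S : Set (Vec m)) (f : Vec m → ℝ) : Vec m :=
  Classical.epsilon fun x => x ∈ S ∧ IsMaxOn f S x

/-- Euclidean projection onto `S`: a minimizer over `S` of the squared distance to `z`. -/
def proj {m : ℕ} (S : Set (Vec m)) (z : Vec m) : Vec m :=
  Classical.epsilon fun y => y ∈ S ∧ IsMinOn (fun y => ‖z - y‖ ^ 2) S y

/-- Agent-wise partial augmented Lagrangian of the smoothed Nash welfare problem. -/
def lagrangian {m : ℕ} (ρ υ : ℝ) (U : Vec m → ℝ) (x z γ : Vec m) : ℝ :=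
  Real.log (U x + υ) - inner ℝ γ (x - z) - ρ / 2 * ‖x - z‖ ^ 2

/-- The iterates: local variables `x i`, global variable `z`, dual variables `γ i`. -/
structure State (n m : ℕ) where
  x : Fin n → Vec m
  z : Vec m
  γ : Fin n → Vec m

/-- The noise vectors `q⁽⁰⁾ = 0` and `q⁽¹⁾, …, q⁽ᴷ⁾` out of a noise realization
(`q⁽ᵏ⁺¹⁾` is the entry of index `k`). -/
def noiseAt {K m : ℕ} (q : Fin K → Vec m) : ℕ → Vec m
  | 0 => 0
  | k + 1 => if h : k < K then q ⟨k, h⟩ else 0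

/-- One iteration, with the current noise vector `q` and the previous one `qPrev`. -/
def step {n m : ℕ} (Z : Set (Vec m)) (U : Fin n → Vec m → ℝ) (ρ υ : ℝ) (qPrev q : Vec m)
    (w : State n m) : State n m :=
  let x : Fin n → Vec m := fun i => argmaxOn Z fun y => lagrangian ρ υ (U i) y w.z (w.γ i)
  let z : Vec m := (1 / (n : ℝ)) • ∑ i, x i + q - qPrev
  { x := x, z := z, γ := fun i => w.γ i + ρ • (x i - z) }

/-- The state after `k` iterations, for the noise realization `q`. -/
def iterate {n m K : ℕ} (Z : Set (Vec m)) (U : Fin n → Vec m → ℝ) (ρ υ : ℝ)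
    (q : Fin K → Vec m) : ℕ → State n m
  | 0 => { x := fun _ => 0, z := 0, γ := fun _ => 0 }
  | k + 1 => step Z U ρ υ (noiseAt q k) (noiseAt q (k + 1)) (iterate Z U ρ υ q k)

/-- The output of the algorithm after `K` iterations, for the noise realization `q`: the
projection of the time average of `z⁽¹⁾, …, z⁽ᴷ⁾` onto the feasible set. -/
def output {n m K : ℕ} (Z : Set (Vec m)) (U : Fin n → Vec m → ℝ) (ρ υ : ℝ)
    (q : Fin K → Vec m) : Vec m :=
  proj Z ((1 / (K : ℝ)) • ∑ k ∈ Finset.Icc 1 K, (iterate Z U ρ υ q k).z)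

/-- The per-iteration privacy level `ε'`. -/
def iterationPrivacy (K : ℕ) (ε δ α : ℝ) : ℝ :=
  (1 / (K : ℝ)) * (ε - Real.log (1 / δ) / (α - 1))

/-- The noise variance `σ²` per coordinate. -/
def noiseVariance (n K : ℕ) (ε δ α : ℝ) : ℝ :=
  α / ((n : ℝ) ^ 2 * iterationPrivacy K ε δ α)

/-- The law of the noise `(q⁽¹⁾, …, q⁽ᴷ⁾)`: independent vectors distributed as `N(0, σ² I_m)`. -/
def noiseLaw (n m K : ℕ) (ε δ α : ℝ) : Measure (Fin K → Vec m) :=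
  Measure.pi fun _ => multivariateGaussian (0 : Vec m)
    (noiseVariance n K ε δ α • (1 : Matrix (Fin m) (Fin m) ℝ))

end PPGA

end

/-! The core property follows from a certificate. If positive numbers `b i ≤ U i z + d` satisfy `∑
i, (U i y + υ) / b i ≤ n (1 + a)` for every feasible `y`, then no coalition `A` blocks `z`. A
blocking `y` would make each term with `i ∈ A` exceed `(1 + a) n / |A|`, and these terms alone would
exceed the bound (`isApproxCore_of_sum_div_le`).

PPGA is a noisy consensus ADMM. Local optimality bounds `(U i y + υ) / (U i (x i) + υ) - 1` by an
inner product with `y - x i` (`div_sub_one_le_inner_of_isMaxOn`). Summed over agents and iterations,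
these inner products telescope in the potential `∑ ‖γ i‖² / (2ρ) + nρ ‖y - z‖² / 2`, up to noise
terms (`sum_sum_inner_gap_le`). Jensen's inequality (`div_le_sum_div`) passes to the time averages
`xbar i`, so `b i = U i (xbar i) + υ` satisfies the sum condition.

It remains to show that `xbar i` is close to the output. The dual updates telescope to `xbar i -
zbar = γ K i / (ρK)`, and `‖γ K i‖² = O(K)` when the mean squared noise is bounded
(`norm_dual_sq_le`). The noise in `zbar` telescopes to `q K / K`, so projecting costs little. A
Chernoff bound controls the total squared noise, the only random quantity needed. -/

/-! ### Concentration of the total squared norm of the Gaussian noise. -/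

theorem multivariateGaussian_zero_smul_one {m : ℕ} {v : ℝ} (hv : 0 ≤ v) :
    multivariateGaussian (0 : EuclideanSpace ℝ (Fin m)) (v • (1 : Matrix (Fin m) (Fin m) ℝ)) =
      (Measure.pi fun _ => gaussianReal 0 v.toNNReal).map (WithLp.toLp 2) := by
  apply Measure.ext_of_charFun (E := EuclideanSpace ℝ (Fin m))
  ext t
  rw [charFun_multivariateGaussian (Matrix.PosSemidef.one.smul hv)]
  simp_rw [charFun_pi, charFun_gaussianReal, ← Complex.exp_sum]
  congr 1
  simp [Matrix.smul_mulVec, dotProduct, Finset.sum_div, hv]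
  refine Finset.sum_congr rfl fun i _ => ?_
  ring

/-- The exponent `1 / (4v)` is half the critical value `1 / (2v)`: the product with the density is
an unnormalized Gaussian of variance `2v`. -/
theorem integral_exp_sq_gaussianReal {v : ℝ} (hv : 0 < v) :
    ∫ x, Real.exp ((4 * v)⁻¹ * x ^ 2) ∂gaussianReal 0 v.toNNReal = √2 := by
  have hv' : v.toNNReal ≠ 0 := by simpa using hv
  rw [integral_gaussianReal_eq_integral_smul hv']
  have h : ∀ x : ℝ, gaussianPDFReal 0 v.toNNReal x • Real.exp ((4 * v)⁻¹ * x ^ 2) =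
      (√(2 * Real.pi * v))⁻¹ * Real.exp (-(4 * v)⁻¹ * x ^ 2) := by
    intro x
    simp only [gaussianPDFReal, smul_eq_mul, Real.coe_toNNReal v hv.le, mul_assoc, ← Real.exp_add]
    congr 2
    field_simp
    ring
  simp_rw [h]
  rw [integral_const_mul, integral_gaussian, ← Real.sqrt_inv, ← Real.sqrt_mul (by positivity)]
  congr 1
  field_simp
  ring

theorem integral_exp_norm_sq_multivariateGaussian {m : ℕ} {v : ℝ} (hv : 0 < v) :
    ∫ x, Real.exp ((4 * v)⁻¹ * ‖x‖ ^ 2) ∂(multivariateGaussian (0 : EuclideanSpace ℝ (Fin m))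
      (v • (1 : Matrix (Fin m) (Fin m) ℝ))) = √2 ^ m := by
  rw [multivariateGaussian_zero_smul_one hv.le, integral_map (by fun_prop) (by fun_prop)]
  simp_rw [EuclideanSpace.real_norm_sq_eq, Finset.mul_sum, Real.exp_sum]
  rw [integral_fintype_prod_eq_pow (fun x : ℝ => Real.exp ((4 * v)⁻¹ * x ^ 2)),
    integral_exp_sq_gaussianReal hv, Fintype.card_fin]

/-- Chernoff bound for the total squared norm of independent isotropic Gaussian vectors. -/
theorem measureReal_sum_norm_sq_ge_le {m K : ℕ} {v : ℝ} (hv : 0 < v) (T : ℝ) :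
    (Measure.pi fun _ : Fin K => multivariateGaussian (0 : EuclideanSpace ℝ (Fin m))
      (v • (1 : Matrix (Fin m) (Fin m) ℝ))).real {q | T ≤ ∑ k, ‖q k‖ ^ 2} ≤
      Real.exp (-(4 * v)⁻¹ * T) * √2 ^ (m * K) := by
  have h : ∫ q, Real.exp ((4 * v)⁻¹ * ∑ k, ‖q k‖ ^ 2)
      ∂(Measure.pi fun _ : Fin K => multivariateGaussian (0 : EuclideanSpace ℝ (Fin m))
        (v • (1 : Matrix (Fin m) (Fin m) ℝ))) = √2 ^ (m * K) := by
    simp_rw [Finset.mul_sum, Real.exp_sum]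
    rw [integral_fintype_prod_eq_pow
      (fun x : EuclideanSpace ℝ (Fin m) => Real.exp ((4 * v)⁻¹ * ‖x‖ ^ 2)),
      integral_exp_norm_sq_multivariateGaussian hv, Fintype.card_fin, pow_mul]
  refine (measure_ge_le_exp_mul_mgf T (t := (4 * v)⁻¹) (by positivity) ?_).trans_eq ?_
  -- A non-integrable function has integral `0` by convention, which contradicts the positive value
  -- in `h`.
  · by_contra hi
    rw [integral_undef hi] at h
    have : 0 < √2 ^ (m * K) := by positivity
    linarith
  · rw [mgf, h]

/-- At the threshold `4vτmK` the Chernoff factor is `exp (-τmK)`, and `√2 ≤ e` bounds the moment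
factor by `exp (mK)`. -/
theorem measureReal_sum_norm_sq_lt_ge {m K : ℕ} {v : ℝ} (hv : 0 < v) (τ : ℝ) :
    1 - Real.exp (-((m * K : ℕ) * (τ - 1))) ≤
      (Measure.pi fun _ : Fin K => multivariateGaussian (0 : EuclideanSpace ℝ (Fin m))
        (v • (1 : Matrix (Fin m) (Fin m) ℝ))).real
        {q | ∑ k, ‖q k‖ ^ 2 < 4 * v * τ * (m * K : ℕ)} := by
  have hset : {q : Fin K → EuclideanSpace ℝ (Fin m) |
      ∑ k, ‖q k‖ ^ 2 < 4 * v * τ * (m * K : ℕ)} =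
      {q | 4 * v * τ * (m * K : ℕ) ≤ ∑ k, ‖q k‖ ^ 2}ᶜ := by
    ext q; simp
  rw [hset, probReal_compl_eq_one_sub (measurableSet_le (by fun_prop) (by fun_prop))]
  have h := measureReal_sum_norm_sq_ge_le (m := m) (K := K) hv (4 * v * τ * (m * K : ℕ))
  have h2 : √2 ^ (m * K) ≤ Real.exp ((m * K : ℕ)) := by
    rw [← mul_one ((m * K : ℕ) : ℝ), Real.exp_nat_mul]
    gcongr
    rw [Real.sqrt_le_left (by positivity)]
    nlinarith [Real.add_one_le_exp (1 : ℝ)]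
  have h3 : Real.exp (-(4 * v)⁻¹ * (4 * v * τ * (m * K : ℕ))) * √2 ^ (m * K) ≤
      Real.exp (-((m * K : ℕ) * (τ - 1))) := by
    calc _ ≤ Real.exp (-(4 * v)⁻¹ * (4 * v * τ * (m * K : ℕ))) * Real.exp ((m * K : ℕ)) := by
          gcongr
      _ = _ := by
          rw [← Real.exp_add]
          congr 1
          field_simp
          ring
  linarith

/-! ### Telescoping estimates for noisy consensus ADMM. -/

/-- The recursion of the consensus ADMM with penalty `ρ`, local variables `x`, global variable `z`,
dual variables `γ` and noise `q`, regardless of how the local variables are chosen. -/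
structure IsConsensusRun {n : ℕ} {E : Type*} [AddCommGroup E] [Module ℝ E] (ρ : ℝ)
    (x : ℕ → Fin n → E) (z : ℕ → E) (γ : ℕ → Fin n → E) (q : ℕ → E) : Prop where
  z_zero : z 0 = 0
  γ_zero : ∀ i, γ 0 i = 0
  q_zero : q 0 = 0
  z_succ : ∀ k, z (k + 1) = (1 / (n : ℝ)) • ∑ i, x (k + 1) i + q (k + 1) - q k
  γ_succ : ∀ k i, γ (k + 1) i = γ k i + ρ • (x (k + 1) i - z (k + 1))

theorem norm_mean_le {n : ℕ} {E : Type*} [NormedAddCommGroup E] [NormedSpace ℝ E] {x : Fin n → E}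
    (hx : ∀ i, ‖x i‖ ≤ 1) : ‖(1 / (n : ℝ)) • ∑ i, x i‖ ≤ 1 := by
  rcases Nat.eq_zero_or_pos n with rfl | hn
  · simp
  · have hn' : (0 : ℝ) < n := by exact_mod_cast hn
    have h : ‖∑ i, x i‖ ≤ n := by
      simpa using norm_sum_le_of_le (f := x) (n := fun _ => (1 : ℝ)) Finset.univ fun i _ => hx i
    rw [norm_smul, Real.norm_of_nonneg (by positivity), one_div_mul_eq_div]
    exact (div_le_one hn').2 h

namespace IsConsensusRun

variable {n : ℕ} {E : Type*} [NormedAddCommGroup E] [InnerProductSpace ℝ E] {ρ : ℝ}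
  {x : ℕ → Fin n → E} {z : ℕ → E} {γ : ℕ → Fin n → E} {q : ℕ → E}

/-- Each step adds `nρ (q k - q (k + 1))` to the sum, because `z` carries a difference of noises;
hence only the current noise survives. -/
theorem sum_dual (h : IsConsensusRun ρ x z γ q) (hn : 0 < n) (k : ℕ) :
    ∑ i, γ k i = -((n : ℝ) * ρ) • q k := by
  have hn' : (n : ℝ) ≠ 0 := by exact_mod_cast hn.ne'
  induction k with
  | zero => simp [h.γ_zero, h.q_zero]
  | succ k ih =>
    have hx : ∑ i, x (k + 1) i = (n : ℝ) • (z (k + 1) - q (k + 1) + q k) := by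
      rw [h.z_succ k, show ∀ a b c : E, a + b - c - b + c = a by intros; abel, smul_smul,
        mul_one_div_cancel hn', one_smul]
    simp only [h.γ_succ, Finset.sum_add_distrib, ih, ← Finset.smul_sum, Finset.sum_sub_distrib, hx,
      Finset.sum_const, Finset.card_univ, Fintype.card_fin, ← Nat.cast_smul_eq_nsmul ℝ]
    module

/-- The three-point identity gives the telescoping difference and a spare `-‖z' - z‖² / 2`, which
absorbs the cross term with `q' - q`. The points `y` and `w` have norm at most 1, so the noise
enters linearly only through `2‖q'‖`. -/
theorem inner_gap_le {y w z z' q q' : E} (hy : ‖y‖ ≤ 1) (hw : ‖w‖ ≤ 1) (hz : z' = w + q' - q) :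
    -inner ℝ q' (y - z') + inner ℝ (z' - z) (y - w) ≤
      ‖y - z‖ ^ 2 / 2 - ‖y - z'‖ ^ 2 / 2 + (2 * ‖q'‖ + 3 * ‖q'‖ ^ 2 + 2 * ‖q‖ ^ 2) := by
  have e1 : -inner ℝ q' (y - z') = inner ℝ q' w - inner ℝ q' y + ‖q'‖ ^ 2 - inner ℝ q' q := by
    simp only [hz, inner_sub_right, inner_add_right, real_inner_self_eq_norm_sq]
    ring
  have e2 : inner ℝ (z' - z) (y - w) = ‖y - z‖ ^ 2 / 2 - ‖y - z'‖ ^ 2 / 2 - ‖z' - z‖ ^ 2 / 2 +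
      inner ℝ (z' - z) (q' - q) := by
    have hw' : y - w = (y - z') + (q' - q) := by rw [hz]; abel
    have hy' : y - z = (y - z') + (z' - z) := by abel
    rw [hw', inner_add_right, hy', norm_add_sq_real, real_inner_comm (z' - z)]
    ring
  have b1 := abs_real_inner_le_norm q' w
  have b2 := abs_real_inner_le_norm q' y
  have b3 := abs_real_inner_le_norm q' q
  have b4 := abs_real_inner_le_norm (z' - z) (q' - q)
  have b5 := norm_sub_le q' q
  have c1 : ‖q'‖ * ‖w‖ ≤ ‖q'‖ := mul_le_of_le_one_right (norm_nonneg _) hw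
  have c2 : ‖q'‖ * ‖y‖ ≤ ‖q'‖ := mul_le_of_le_one_right (norm_nonneg _) hy
  have c4 : ‖q' - q‖ ^ 2 ≤ (‖q'‖ + ‖q‖) ^ 2 := by gcongr
  rw [abs_le] at b1 b2 b3 b4
  nlinarith [sq_nonneg (‖q'‖ - ‖q‖), sq_nonneg (‖z' - z‖ - ‖q' - q‖)]

/-- One-step decrease of the potential. The dual part is the polarization identity for `γ k i`, `γ
(k + 1) i`; what is left pairs `∑ i, γ (k + 1) i` with `y - z (k + 1)`, and that sum is pure noise
by `sum_dual`. -/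
theorem sum_inner_gap_le (h : IsConsensusRun ρ x z γ q) (hn : 0 < n) (hρ : 0 < ρ) {y : E}
    (hy : ‖y‖ ≤ 1) (k : ℕ) (hx : ∀ i, ‖x (k + 1) i‖ ≤ 1) :
    ∑ i, inner ℝ (γ (k + 1) i + ρ • (z (k + 1) - z k)) (y - x (k + 1) i) ≤
      (∑ i, ‖γ k i‖ ^ 2 / (2 * ρ) + n * ρ * (‖y - z k‖ ^ 2 / 2)) -
      (∑ i, ‖γ (k + 1) i‖ ^ 2 / (2 * ρ) + n * ρ * (‖y - z (k + 1)‖ ^ 2 / 2)) +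
      n * ρ * (2 * ‖q (k + 1)‖ + 3 * ‖q (k + 1)‖ ^ 2 + 2 * ‖q k‖ ^ 2) := by
  have hn' : (n : ℝ) ≠ 0 := by exact_mod_cast hn.ne'
  set w := (1 / (n : ℝ)) • ∑ i, x (k + 1) i with hw
  have hsum : ∑ i, x (k + 1) i = (n : ℝ) • w := by
    rw [hw, smul_smul, mul_one_div_cancel hn', one_smul]
  have e1 : ∀ i, inner ℝ (γ (k + 1) i + ρ • (z (k + 1) - z k)) (y - x (k + 1) i) ≤
      ‖γ k i‖ ^ 2 / (2 * ρ) - ‖γ (k + 1) i‖ ^ 2 / (2 * ρ) + inner ℝ (γ (k + 1) i) (y - z (k + 1)) +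
      ρ * inner ℝ (z (k + 1) - z k) (y - x (k + 1) i) := by
    intro i
    have hγ : γ (k + 1) i - γ k i = ρ • (x (k + 1) i - z (k + 1)) := by
      rw [h.γ_succ k i]; abel
    have e : inner ℝ (γ (k + 1) i) (γ (k + 1) i - γ k i) =
        ρ * inner ℝ (γ (k + 1) i) (x (k + 1) i - z (k + 1)) := by rw [hγ, inner_smul_right]
    have e' : ‖γ k i‖ ^ 2 = ‖γ (k + 1) i‖ ^ 2 - 2 * inner ℝ (γ (k + 1) i) (γ (k + 1) i - γ k i) +
        ‖γ (k + 1) i - γ k i‖ ^ 2 := by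
      rw [← norm_sub_sq_real]; congr 2; abel
    rw [inner_add_left, real_inner_smul_left,
      show y - x (k + 1) i = (y - z (k + 1)) - (x (k + 1) i - z (k + 1)) by abel,
      inner_sub_right (γ (k + 1) i)]
    have e3 : inner ℝ (γ (k + 1) i) (x (k + 1) i - z (k + 1)) =
        (‖γ (k + 1) i‖ ^ 2 - ‖γ k i‖ ^ 2 + ‖γ (k + 1) i - γ k i‖ ^ 2) / (2 * ρ) := by
      rw [e', e]; field_simp; ring
    rw [e3]
    have : 0 ≤ ‖γ (k + 1) i - γ k i‖ ^ 2 / (2 * ρ) := by positivity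
    rw [add_div, sub_div]
    linarith
  have e2 : ∑ i, inner ℝ (γ (k + 1) i) (y - z (k + 1)) =
      n * ρ * (-inner ℝ (q (k + 1)) (y - z (k + 1))) := by
    rw [← sum_inner, h.sum_dual hn, real_inner_smul_left]
    ring
  have e3 : ∑ i, ρ * inner ℝ (z (k + 1) - z k) (y - x (k + 1) i) =
      n * ρ * inner ℝ (z (k + 1) - z k) (y - w) := by
    rw [← Finset.mul_sum, ← inner_sum, Finset.sum_sub_distrib, hsum]
    simp only [Finset.sum_const, Finset.card_univ, Fintype.card_fin, ← Nat.cast_smul_eq_nsmul ℝ]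
    rw [← smul_sub, inner_smul_right]
    ring
  have e4 := mul_le_mul_of_nonneg_left (inner_gap_le (z := z k) hy (norm_mean_le hx) (h.z_succ k))
    (show 0 ≤ (n : ℝ) * ρ by positivity)
  have e5 := Finset.sum_le_sum fun i (_ : i ∈ Finset.univ) => e1 i
  simp only [Finset.sum_add_distrib, Finset.sum_sub_distrib] at e5
  rw [e2, e3] at e5
  rw [← hw] at e4
  linarith

theorem sum_range_le_sum_range_succ {f : ℕ → ℝ} (h0 : f 0 = 0) (hf : ∀ k, 0 ≤ f k) (K : ℕ) :
    ∑ k ∈ Finset.range K, f k ≤ ∑ k ∈ Finset.range K, f (k + 1) := by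
  have := Finset.sum_range_succ' f K
  rw [Finset.sum_range_succ] at this
  linarith [hf K]

/-- The time-averaged variational gap of a consensus run against any fixed comparison point. -/
theorem sum_sum_inner_gap_le (h : IsConsensusRun ρ x z γ q) (hn : 0 < n) (hρ : 0 < ρ) {y : E}
    (hy : ‖y‖ ≤ 1) (hx : ∀ k i, ‖x (k + 1) i‖ ≤ 1) (K : ℕ) :
    ∑ k ∈ Finset.range K, ∑ i,
      inner ℝ (γ (k + 1) i + ρ • (z (k + 1) - z k)) (y - x (k + 1) i) ≤
      n * ρ * (1 / 2 + 2 * ∑ k ∈ Finset.range K, ‖q (k + 1)‖ +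
        5 * ∑ k ∈ Finset.range K, ‖q (k + 1)‖ ^ 2) := by
  have h1 := Finset.sum_le_sum fun k (_ : k ∈ Finset.range K) =>
    h.sum_inner_gap_le hn hρ hy k (hx k)
  rw [Finset.sum_add_distrib, Finset.sum_range_sub', ← Finset.mul_sum, Finset.sum_add_distrib,
    Finset.sum_add_distrib, ← Finset.mul_sum, ← Finset.mul_sum, ← Finset.mul_sum] at h1
  have h2 := sum_range_le_sum_range_succ (f := fun k => ‖q k‖ ^ 2) (by simp [h.q_zero])
    (fun k => by positivity) K
  have h3 : ‖y‖ ^ 2 ≤ 1 := pow_le_one₀ (norm_nonneg _) hy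
  have h4 : 0 ≤ ∑ i, ‖γ K i‖ ^ 2 / (2 * ρ) := by positivity
  have h5 : 0 ≤ n * ρ * (‖y - z K‖ ^ 2 / 2) := by positivity
  simp only [h.γ_zero, h.z_zero, sub_zero, norm_zero] at h1
  have h6 : (0 : ℝ) < n * ρ := by positivity
  have h7 := mul_le_mul_of_nonneg_left h2 h6.le
  have h8 := mul_le_mul_of_nonneg_left h3 h6.le
  norm_num at h1
  linarith

theorem norm_z_succ_le (h : IsConsensusRun ρ x z γ q) {k : ℕ} (hx : ∀ i, ‖x (k + 1) i‖ ≤ 1) :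
    ‖z (k + 1)‖ ≤ 1 + ‖q (k + 1)‖ + ‖q k‖ := by
  rw [h.z_succ k]
  refine (norm_sub_le _ _).trans (add_le_add_left ?_ _)
  exact (norm_add_le _ _).trans (add_le_add_left (norm_mean_le hx) _)

/-- Comparing agent `i` with the mean of the local variables, `hvar` says that `‖γ k i‖² / (2ρ) + ⟪γ
k i, q k⟫` grows by a bounded amount per step, up to noise. Summation gives linear growth of `‖γ K
i‖²`. -/
theorem norm_dual_sq_le (h : IsConsensusRun ρ x z γ q) (hρ : 0 < ρ)
    (hx : ∀ k i, ‖x (k + 1) i‖ ≤ 1) (i : Fin n)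
    (hvar : ∀ k, -1 ≤ inner ℝ (γ (k + 1) i + ρ • (z (k + 1) - z k))
      ((1 / (n : ℝ)) • ∑ j, x (k + 1) j - x (k + 1) i)) (K : ℕ) :
    ‖γ K i‖ ^ 2 ≤ (4 * ρ + 32 * ρ ^ 2) * K +
      22 * ρ ^ 2 * ∑ k ∈ Finset.range K, ‖q (k + 1)‖ ^ 2 := by
  have hstep : ∀ k, (‖γ (k + 1) i‖ ^ 2 / (2 * ρ) + inner ℝ (γ (k + 1) i) (q (k + 1))) -
      (‖γ k i‖ ^ 2 / (2 * ρ) + inner ℝ (γ k i) (q k)) ≤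
      1 + ρ / 2 * ‖q k‖ ^ 2 + 2 * ρ * (‖z (k + 1)‖ + ‖z k‖) := by
    intro k
    set w := (1 / (n : ℝ)) • ∑ j, x (k + 1) j with hw
    have hγ : γ (k + 1) i - γ k i = ρ • (x (k + 1) i - z (k + 1)) := by
      rw [h.γ_succ k i]; abel
    have hwx : w - x (k + 1) i = -((1 / ρ) • (γ (k + 1) i - γ k i)) - (q (k + 1) - q k) := by
      rw [hγ, smul_smul, one_div_mul_cancel hρ.ne', one_smul, h.z_succ k, ← hw]
      abel
    have e1 : inner ℝ (γ (k + 1) i) (w - x (k + 1) i) =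
        -(1 / ρ) * inner ℝ (γ (k + 1) i) (γ (k + 1) i - γ k i) -
          inner ℝ (γ (k + 1) i) (q (k + 1)) + inner ℝ (γ k i) (q k) +
          inner ℝ (γ (k + 1) i - γ k i) (q k) := by
      rw [hwx]
      simp only [inner_sub_right, inner_sub_left, inner_neg_right, inner_smul_right]
      ring
    have e' : ‖γ k i‖ ^ 2 = ‖γ (k + 1) i‖ ^ 2 - 2 * inner ℝ (γ (k + 1) i) (γ (k + 1) i - γ k i) +
        ‖γ (k + 1) i - γ k i‖ ^ 2 := by
      rw [← norm_sub_sq_real]; congr 2; abel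
    have e2 : (1 / ρ) * inner ℝ (γ (k + 1) i) (γ (k + 1) i - γ k i) = ‖γ (k + 1) i‖ ^ 2 / (2 * ρ) -
        ‖γ k i‖ ^ 2 / (2 * ρ) + ‖γ (k + 1) i - γ k i‖ ^ 2 / (2 * ρ) := by
      rw [e']; field_simp; ring
    have e3 : inner ℝ (γ (k + 1) i - γ k i) (q k) ≤
        ‖γ (k + 1) i - γ k i‖ ^ 2 / (2 * ρ) + ρ / 2 * ‖q k‖ ^ 2 := by
      refine (real_inner_le_norm _ _).trans ?_
      have : ‖γ (k + 1) i - γ k i‖ ^ 2 / (2 * ρ) + ρ / 2 * ‖q k‖ ^ 2 -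
          ‖γ (k + 1) i - γ k i‖ * ‖q k‖ =
          (‖γ (k + 1) i - γ k i‖ - ρ * ‖q k‖) ^ 2 / (2 * ρ) := by field_simp; ring
      have : 0 ≤ (‖γ (k + 1) i - γ k i‖ - ρ * ‖q k‖) ^ 2 / (2 * ρ) := by positivity
      linarith
    have e4 : inner ℝ (ρ • (z (k + 1) - z k)) (w - x (k + 1) i) ≤
        2 * ρ * (‖z (k + 1)‖ + ‖z k‖) := by
      rw [real_inner_smul_left]
      have a1 := real_inner_le_norm (z (k + 1) - z k) (w - x (k + 1) i)
      have a2 : ‖w - x (k + 1) i‖ ≤ 2 := by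
        linarith [norm_sub_le w (x (k + 1) i), hx k i, norm_mean_le (hx k)]
      have a3 := mul_le_mul (norm_sub_le (z (k + 1)) (z k)) a2 (norm_nonneg _) (by positivity)
      nlinarith [mul_le_mul_of_nonneg_left (a1.trans a3) hρ.le]
    have h1 := hvar k
    rw [inner_add_left, e1] at h1
    linarith
  have h1 := Finset.sum_le_sum fun k (_ : k ∈ Finset.range K) => hstep k
  rw [Finset.sum_range_sub (fun k => ‖γ k i‖ ^ 2 / (2 * ρ) + inner ℝ (γ k i) (q k))] at h1
  simp only [h.γ_zero, norm_zero, inner_zero_left, Finset.sum_add_distrib, ← Finset.mul_sum,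
    Finset.sum_const, Finset.card_range, nsmul_eq_mul, mul_one] at h1
  have hq2 := sum_range_le_sum_range_succ (f := fun k => ‖q k‖ ^ 2) (by simp [h.q_zero])
    (fun k => by positivity) K
  have hq1 := sum_range_le_sum_range_succ (f := fun k => ‖q k‖) (by simp [h.q_zero])
    (fun k => by positivity) K
  have hz1 := sum_range_le_sum_range_succ (f := fun k => ‖z k‖) (by simp [h.z_zero])
    (fun k => by positivity) K
  have hz2 := Finset.sum_le_sum fun k (_ : k ∈ Finset.range K) => h.norm_z_succ_le (hx k)
  have hq12 : ∑ k ∈ Finset.range K, ‖q (k + 1)‖ ≤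
      ∑ k ∈ Finset.range K, (1 / 2 + ‖q (k + 1)‖ ^ 2 / 2) :=
    Finset.sum_le_sum fun k _ => by nlinarith [sq_nonneg (‖q (k + 1)‖ - 1)]
  simp only [Finset.sum_add_distrib, Finset.sum_const, Finset.card_range, nsmul_eq_mul, mul_one,
    ← Finset.sum_div] at hz2 hq12
  have hlast : ‖q K‖ ^ 2 ≤ ∑ k ∈ Finset.range K, ‖q (k + 1)‖ ^ 2 := by
    rcases K with _ | K
    · simp [h.q_zero]
    · exact Finset.single_le_sum (f := fun k => ‖q (k + 1)‖ ^ 2) (fun k _ => by positivity)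
        (Finset.self_mem_range_succ K)
  set B := ∑ k ∈ Finset.range K, ‖q (k + 1)‖ ^ 2
  set Q := ∑ k ∈ Finset.range K, ‖q (k + 1)‖
  -- Young's inequality, weighted so that the cross term consumes only half of `‖γ K i‖² / (2ρ)`.
  have hcross : -(‖γ K i‖ ^ 2 / (4 * ρ) + ρ * ‖q K‖ ^ 2) ≤ inner ℝ (γ K i) (q K) := by
    have a := (abs_le.1 (abs_real_inner_le_norm (γ K i) (q K))).1
    have : ‖γ K i‖ ^ 2 / (4 * ρ) + ρ * ‖q K‖ ^ 2 - ‖γ K i‖ * ‖q K‖ =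
        (‖γ K i‖ - 2 * ρ * ‖q K‖) ^ 2 / (4 * ρ) := by field_simp; ring
    have : 0 ≤ (‖γ K i‖ - 2 * ρ * ‖q K‖) ^ 2 / (4 * ρ) := by positivity
    linarith
  have hz3 : ∑ k ∈ Finset.range K, ‖z (k + 1)‖ + ∑ k ∈ Finset.range K, ‖z k‖ ≤
      4 * K + 2 * B := by
    linarith
  have h2 : ‖γ K i‖ ^ 2 / (2 * ρ) - ‖γ K i‖ ^ 2 / (4 * ρ) ≤
      K + ρ / 2 * B + 2 * ρ * (4 * K + 2 * B) + ρ * B := by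
    have a1 := mul_le_mul_of_nonneg_left hz3 (show 0 ≤ 2 * ρ by positivity)
    have a2 := mul_le_mul_of_nonneg_left hq2 (show 0 ≤ ρ / 2 by positivity)
    have a3 := mul_le_mul_of_nonneg_left hlast hρ.le
    norm_num at h1
    linarith
  have h3 : ‖γ K i‖ ^ 2 / (2 * ρ) - ‖γ K i‖ ^ 2 / (4 * ρ) = ‖γ K i‖ ^ 2 / (4 * ρ) := by
    field_simp; ring
  rw [h3, div_le_iff₀ (by positivity)] at h2
  linarith

theorem sum_z (h : IsConsensusRun ρ x z γ q) (K : ℕ) :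
    ∑ k ∈ Finset.range K, z (k + 1) =
      ∑ k ∈ Finset.range K, (1 / (n : ℝ)) • ∑ i, x (k + 1) i + q K := by
  simp only [h.z_succ, add_sub_assoc, Finset.sum_add_distrib]
  rw [Finset.sum_range_sub, h.q_zero, sub_zero]

theorem sum_x_sub_z (h : IsConsensusRun ρ x z γ q) (hρ : 0 < ρ) (i : Fin n) (K : ℕ) :
    ∑ k ∈ Finset.range K, x (k + 1) i - ∑ k ∈ Finset.range K, z (k + 1) = (1 / ρ) • γ K i := by
  have h1 : ∀ k, x (k + 1) i - z (k + 1) = (1 / ρ) • γ (k + 1) i - (1 / ρ) • γ k i := by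
    intro k
    rw [h.γ_succ k i, ← smul_sub, add_sub_cancel_left, smul_smul, one_div_mul_cancel hρ.ne',
      one_smul]
  rw [← Finset.sum_sub_distrib, Finset.sum_congr rfl fun k _ => h1 k,
    Finset.sum_range_sub fun k => (1 / ρ) • γ k i, h.γ_zero, smul_zero, sub_zero]

end IsConsensusRun

/-! ### Feasible set, first-order optimality, Jensen's inequality and the core certificate. -/

namespace PPGA

variable {n m : ℕ}

theorem convex_feasible (s : Fin m → ℝ) (c : ℝ) : Convex ℝ (feasible s c) := by
  intro x hx y hy a b ha hb hab
  refine ⟨fun j => ?_, ?_, fun j => ?_⟩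
  · exact (convex_Icc (0 : ℝ) 1) (hx.1 j) (hy.1 j) ha hb hab
  · calc ∑ j, |(a • x + b • y) j| ≤ ∑ j, (a * |x j| + b * |y j|) := by
          refine Finset.sum_le_sum fun j _ => (abs_add_le _ _).trans_eq ?_
          simp [abs_mul, abs_of_nonneg ha, abs_of_nonneg hb]
      _ = a * ∑ j, |x j| + b * ∑ j, |y j| := by
          rw [Finset.sum_add_distrib, Finset.mul_sum, Finset.mul_sum]
      _ ≤ a * 1 + b * 1 := by gcongr; exacts [hx.2.1, hy.2.1]
      _ = 1 := by linarith
  · have h1 := mul_le_mul_of_nonneg_left (hx.2.2 j) ha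
    have h2 := mul_le_mul_of_nonneg_left (hy.2.2 j) hb
    calc c * (a * x j + b * y j) = a * (c * x j) + b * (c * y j) := by ring
      _ ≤ a * s j + b * s j := add_le_add h1 h2
      _ = s j := by rw [← add_mul, hab, one_mul]

theorem zero_mem_feasible {s : Fin m → ℝ} (hs : ∀ j, 0 < s j) (c : ℝ) : 0 ∈ feasible s c :=
  ⟨fun j => by simp, by simp, fun j => by simpa using (hs j).le⟩

theorem norm_le_one_of_mem_feasible {s : Fin m → ℝ} {c : ℝ} {z : Vec m} (hz : z ∈ feasible s c) :
    ‖z‖ ≤ 1 := by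
  rw [EuclideanSpace.norm_eq, Real.sqrt_le_one]
  refine le_trans (Finset.sum_le_sum fun j _ => ?_) hz.2.1
  rw [Real.norm_eq_abs, abs_of_nonneg (hz.1 j).1]
  exact pow_le_of_le_one (hz.1 j).1 (hz.1 j).2 two_ne_zero

theorem isCompact_feasible (s : Fin m → ℝ) (c : ℝ) : IsCompact (feasible s c) := by
  refine Metric.isCompact_of_isClosed_isBounded ?_ ?_
  · have h1 : IsClosed {z : Vec m | ∀ j, z j ∈ Set.Icc (0 : ℝ) 1} := by
      simp only [Set.ofPred_forall]
      exact isClosed_iInter fun j => isClosed_Icc.preimage (by fun_prop)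
    have h2 : IsClosed {z : Vec m | ∑ j, |z j| ≤ 1} := isClosed_le (by fun_prop) (by fun_prop)
    have h3 : IsClosed {z : Vec m | ∀ j, c * z j ≤ s j} := by
      simp only [Set.ofPred_forall]
      exact isClosed_iInter fun j => isClosed_le (by fun_prop) (by fun_prop)
    exact h1.inter (h2.inter h3)
  · exact (Metric.isBounded_closedBall (x := (0 : Vec m)) (r := 1)).subset fun z hz => by
      simpa using norm_le_one_of_mem_feasible hz

theorem argmaxOn_spec {S : Set (Vec m)} {f : Vec m → ℝ} (hS : IsCompact S) (hne : S.Nonempty)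
    (hf : ContinuousOn f S) : argmaxOn S f ∈ S ∧ IsMaxOn f S (argmaxOn S f) :=
  Classical.epsilon_spec (hS.exists_isMaxOn hne hf)

theorem proj_spec {S : Set (Vec m)} (hS : IsCompact S) (hne : S.Nonempty) (z : Vec m) :
    proj S z ∈ S ∧ IsMinOn (fun y => ‖z - y‖ ^ 2) S (proj S z) :=
  Classical.epsilon_spec (hS.exists_isMinOn hne (by fun_prop))

theorem norm_sub_proj_le {S : Set (Vec m)} (hS : IsCompact S) (z : Vec m) {w : Vec m}
    (hw : w ∈ S) : ‖z - proj S z‖ ≤ ‖z - w‖ :=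
  (sq_le_sq₀ (norm_nonneg _) (norm_nonneg _)).1 ((proj_spec hS ⟨w, hw⟩ z).2 hw)

theorem continuousOn_lagrangian {Z : Set (Vec m)} {U : Vec m → ℝ} {ρ υ : ℝ} (hυ : 0 < υ)
    (hU : ContinuousOn U Z) (h0 : ∀ x ∈ Z, 0 ≤ U x) (z γ : Vec m) :
    ContinuousOn (fun y => lagrangian ρ υ U y z γ) Z := by
  unfold lagrangian
  refine ((ContinuousOn.log (hU.add continuousOn_const) fun x hx => ?_).sub (by fun_prop)).sub
    (by fun_prop)
  exact (by linarith [h0 x hx] : 0 < U x + υ).ne'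

/-- First-order optimality of a maximizer of the agent-wise augmented Lagrangian. It requires
concavity of the utility only. -/
theorem div_sub_one_le_inner_of_isMaxOn {Z : Set (Vec m)} {U : Vec m → ℝ} {ρ υ : ℝ} (hυ : 0 < υ)
    (hU : ConcaveOn ℝ Z U) (h0 : ∀ x ∈ Z, 0 ≤ U x) {x z γ : Vec m} (hx : x ∈ Z)
    (hmax : IsMaxOn (fun y => lagrangian ρ υ U y z γ) Z x) {y : Vec m} (hy : y ∈ Z) :
    (U y + υ) / (U x + υ) - 1 ≤ inner ℝ (γ + ρ • (x - z)) (y - x) := by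
  have hbx : 0 < U x + υ := by linarith [h0 x hx]
  have hby : 0 < U y + υ := by linarith [h0 y hy]
  set R := (U y + υ) / (U x + υ) - 1 with hR
  set I := inner ℝ (γ + ρ • (x - z)) (y - x) with hI
  -- Compare `x` with `(1 - t) • x + t • y`. Concavity gives a gain of at least `log (1 + tR) ≥ 1 -
  -- (1 + tR)⁻¹`; dividing by `t` and letting `t → 0⁺` yields the claim without any derivative of
  -- `U`.
  have key : ∀ t ∈ Set.Ioo (0 : ℝ) 1, R ≤ (I + ρ / 2 * t * ‖y - x‖ ^ 2) * (1 + t * R) := by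
    intro t ht
    have hpos : 0 < 1 + t * R := by
      have : 1 + t * R = (1 - t) + t * ((U y + υ) / (U x + υ)) := by rw [hR]; ring
      rw [this]
      have := ht.1
      have := ht.2
      have : 0 < 1 - t := by linarith
      positivity
    set w := (1 - t) • x + t • y with hw
    have hwZ : w ∈ Z := hU.1 hx hy (by linarith [ht.2]) ht.1.le (by ring)
    have hUw : (1 - t) * U x + t * U y ≤ U w := by
      simpa using hU.2 hx hy (show 0 ≤ 1 - t by linarith [ht.2]) ht.1.le (by ring)
    have hlog : Real.log (U x + υ) + (1 - (1 + t * R)⁻¹) ≤ Real.log (U w + υ) := by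
      have h1 : (U x + υ) * (1 + t * R) ≤ U w + υ := by
        have : (U x + υ) * (1 + t * R) = (1 - t) * U x + t * U y + υ := by
          rw [hR]; field_simp; ring
        linarith
      have h2 := Real.log_le_log (by positivity) h1
      rw [Real.log_mul hbx.ne' hpos.ne'] at h2
      linarith [Real.one_sub_inv_le_log_of_pos hpos]
    have hle : lagrangian ρ υ U w z γ ≤ lagrangian ρ υ U x z γ := hmax hwZ
    unfold lagrangian at hle
    have hwz : w - z = (x - z) + t • (y - x) := by rw [hw]; module
    rw [hwz, inner_add_right, norm_add_sq_real, inner_smul_right, inner_smul_right, norm_smul,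
      mul_pow, Real.norm_eq_abs, sq_abs] at hle
    have hI' : I = inner ℝ γ (y - x) + ρ * inner ℝ (x - z) (y - x) := by
      rw [hI, inner_add_left, real_inner_smul_left]
    have h3 : 1 - (1 + t * R)⁻¹ ≤ t * (I + ρ / 2 * t * ‖y - x‖ ^ 2) := by
      rw [hI']; linarith
    have h4 : 1 - (1 + t * R)⁻¹ = t * (R / (1 + t * R)) := by field_simp; ring
    rw [h4] at h3
    exact (div_le_iff₀ hpos).1 (le_of_mul_le_mul_left h3 ht.1)
  have hlim : Tendsto (fun t : ℝ => (I + ρ / 2 * t * ‖y - x‖ ^ 2) * (1 + t * R)) (𝓝[>] 0)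
      (𝓝 ((I + ρ / 2 * 0 * ‖y - x‖ ^ 2) * (1 + 0 * R))) :=
    (Continuous.tendsto (by fun_prop) 0).mono_left nhdsWithin_le_nhds
  have := ge_of_tendsto hlim (Filter.eventually_of_mem (Ioo_mem_nhdsGT one_pos) key)
  simpa using this

/-- Jensen's inequality for the reciprocal of a concave positive function. -/
theorem div_le_sum_div {E : Type*} [AddCommGroup E] [Module ℝ E] {Z : Set E} {V : E → ℝ}
    (hV : ConcaveOn ℝ Z V) (h0 : ∀ x ∈ Z, 0 < V x) {K : ℕ} (hK : 0 < K) {x : ℕ → E}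
    (hx : ∀ k, x k ∈ Z) {b : ℝ} (hb : 0 ≤ b) :
    K * (b / V ((1 / (K : ℝ)) • ∑ k ∈ Finset.range K, x k)) ≤
      ∑ k ∈ Finset.range K, b / V (x k) := by
  have hK' : (0 : ℝ) < K := by exact_mod_cast hK
  have hsum : ∑ _k ∈ Finset.range K, 1 / (K : ℝ) = 1 := by
    simp [hK'.ne']
  have hmem : (1 / (K : ℝ)) • ∑ k ∈ Finset.range K, x k ∈ Z := by
    rw [Finset.smul_sum]
    exact hV.1.sum_mem (fun _ _ => by positivity) hsum fun k _ => hx k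
  have hJ : ∑ k ∈ Finset.range K, (1 / (K : ℝ)) * V (x k) ≤
      V ((1 / (K : ℝ)) • ∑ k ∈ Finset.range K, x k) := by
    rw [Finset.smul_sum]
    simpa using hV.le_map_sum (t := Finset.range K) (w := fun _ => 1 / (K : ℝ)) (p := x)
      (fun _ _ => by positivity) hsum fun k _ => hx k
  set a := V ((1 / (K : ℝ)) • ∑ k ∈ Finset.range K, x k)
  have ha : 0 < a := h0 _ hmem
  -- The tangent of `v ↦ 1 / v` at `a` lies below its graph; concavity of `V` then bounds the mean
  -- of the `V (x k)` by `a`.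
  have htan : ∀ k ∈ Finset.range K, b * (2 / a - V (x k) / a ^ 2) ≤ b / V (x k) := by
    intro k _
    have hk := h0 _ (hx k)
    rw [div_eq_mul_one_div b]
    refine mul_le_mul_of_nonneg_left ?_ hb
    rw [← sub_nonneg, show 1 / V (x k) - (2 / a - V (x k) / a ^ 2) =
      (V (x k) - a) ^ 2 / (V (x k) * a ^ 2) by field_simp; ring]
    positivity
  refine le_trans ?_ (Finset.sum_le_sum htan)
  rw [← Finset.mul_sum, Finset.sum_sub_distrib, ← Finset.sum_div, Finset.sum_const,
    Finset.card_range, nsmul_eq_mul, mul_div_assoc', mul_comm (K : ℝ), mul_div_assoc, mul_div_assoc]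
  refine mul_le_mul_of_nonneg_left ?_ hb
  rw [← Finset.mul_sum, one_div_mul_eq_div, div_le_iff₀ hK'] at hJ
  have : (∑ k ∈ Finset.range K, V (x k)) / a ^ 2 ≤ a * K / a ^ 2 := by gcongr
  have e : a * K / a ^ 2 = K / a := by field_simp
  rw [e, Finset.sum_div] at this
  have e2 : K * (2 / a) = K / a + K / a := by ring
  linarith

/-- If `∑ i, (U i y + υ) / b i ≤ n (1 + a)` for all feasible `y`, where `b i` approximates
`U i z + υ`, then `z` is in the approximate core. -/
theorem isApproxCore_of_sum_div_le {Z : Set (Vec m)} {U : Fin n → Vec m → ℝ} {a d υ : ℝ}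
    {z : Vec m} {b : Fin n → ℝ} (hn : 0 < n) (hz : z ∈ Z) (hU : ∀ i, ∀ x ∈ Z, 0 ≤ U i x)
    (hυ : 0 < υ) (ha : 0 ≤ a) (hb : ∀ i, 0 < b i) (hbd : ∀ i, b i ≤ U i z + d)
    (hsum : ∀ y ∈ Z, ∑ i, (U i y + υ) / b i ≤ n * (1 + a)) :
    IsApproxCore Z U a (d * (1 + a)) z := by
  refine ⟨hz, ?_⟩
  rintro ⟨A, y, hy, hA, i₀, hi₀, -⟩
  have hn' : (0 : ℝ) < n := by exact_mod_cast hn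
  have hcard : (0 : ℝ) < A.card := by exact_mod_cast Finset.card_pos.2 ⟨i₀, hi₀⟩
  -- Strictness comes from `υ > 0`.
  have h1 : ∀ i ∈ A, (1 + a) * (n / A.card) < (U i y + υ) / b i := by
    intro i hi
    have h2 := hA i hi
    have h3 : (1 + a) * b i ≤ A.card / n * U i y := by
      nlinarith [mul_le_mul_of_nonneg_left (hbd i) (show 0 ≤ 1 + a by linarith)]
    rw [lt_div_iff₀ (hb i)]
    calc (1 + a) * (n / A.card) * b i = (n / A.card) * ((1 + a) * b i) := by ring
      _ ≤ (n / A.card) * (A.card / n * U i y) := by gcongr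
      _ = U i y := by field_simp
      _ < U i y + υ := by linarith
  have h2 := Finset.sum_lt_sum_of_nonempty ⟨i₀, hi₀⟩ h1
  have h3 : ∑ i ∈ A, (U i y + υ) / b i ≤ ∑ i, (U i y + υ) / b i :=
    Finset.sum_le_sum_of_subset_of_nonneg (Finset.subset_univ A) fun i _ _ => by
      have := hU i y hy
      have := hb i
      positivity
  have h4 : ∑ _i ∈ A, (1 + a) * (n / A.card) = n * (1 + a) := by
    rw [Finset.sum_const, nsmul_eq_mul]; field_simp
  linarith [hsum y hy]

theorem isApproxCore_of_one_le {Z : Set (Vec m)} {U : Fin n → Vec m → ℝ} {a d : ℝ} {z : Vec m}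
    (hz : z ∈ Z) (hU : ∀ i, ∀ x ∈ Z, U i x ∈ Set.Icc (0 : ℝ) 1) (ha : 0 ≤ a) (hd : 1 ≤ d) :
    IsApproxCore Z U a d z := by
  refine ⟨hz, ?_⟩
  rintro ⟨A, y, hy, -, i, -, hi⟩
  have h1 : (A.card : ℝ) / n ≤ 1 := by
    refine div_le_one_of_le₀ ?_ (by positivity)
    exact_mod_cast (Finset.card_le_univ A).trans_eq (Fintype.card_fin n)
  have h2 := mul_le_mul h1 (hU i y hy).2 (hU i y hy).1 zero_le_one
  have h3 : 0 ≤ (1 + a) * U i z := mul_nonneg (by linarith) (hU i z hz).1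
  linarith

theorem isConsensusRun_iterate {K : ℕ} (Z : Set (Vec m)) (U : Fin n → Vec m → ℝ) (ρ υ : ℝ)
    (q : Fin K → Vec m) :
    IsConsensusRun ρ (fun k => (iterate Z U ρ υ q k).x) (fun k => (iterate Z U ρ υ q k).z)
      (fun k => (iterate Z U ρ υ q k).γ) (noiseAt q) where
  z_zero := rfl
  γ_zero _ := rfl
  q_zero := rfl
  z_succ _ := rfl
  γ_succ _ _ := rfl

theorem sum_noiseAt {K : ℕ} (q : Fin K → Vec m) (f : Vec m → ℝ) :
    ∑ k ∈ Finset.range K, f (noiseAt q (k + 1)) = ∑ k, f (q k) := by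
  rw [Finset.sum_range]
  exact Finset.sum_congr rfl fun k _ => by simp [noiseAt]

theorem sum_abs_le_sqrt_mul_norm (v : Vec m) : ∑ j, |v j| ≤ √m * ‖v‖ := by
  rw [EuclideanSpace.norm_eq, ← Real.sqrt_mul (by positivity)]
  refine Real.le_sqrt_of_sq_le ?_
  simpa using sq_sum_le_card_mul_sum_sq (s := Finset.univ) (f := fun j => |v j|)

end PPGA

/-! ### Deterministic guarantee and conversion to rates. -/

namespace PPGA

variable {n m : ℕ}

/-- Deterministic guarantee for a noise realization whose mean squared norm is at most `S`. -/
theorem isApproxCore_output {K : ℕ} {s : Fin m → ℝ} {c ρ β L υ S a d : ℝ}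
    {U : Fin n → Vec m → ℝ} (hn : 0 < n) (hK : 0 < K) (hs : ∀ j, 0 < s j) (hρ : 0 < ρ)
    (hL : 0 ≤ L) (hυ : 0 < υ) (hU : ∀ i, IsUtility (feasible s c) β (U i))
    (hLip : ∀ i, ∀ x ∈ feasible s c, ∀ y ∈ feasible s c,
      |U i x - U i y| ≤ L * ∑ j, |x j - y j|) (q : Fin K → Vec m)
    (hq : ∑ k, ‖q k‖ ^ 2 ≤ S * K)
    (ha : ρ * (1 / (2 * K) + 2 * √S + 5 * S) ≤ a)
    (hd : υ + L * (√m / √K) * (√(4 * ρ + 32 * ρ ^ 2 + 22 * ρ ^ 2 * S) / ρ + √S) ≤ d) :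
    IsApproxCore (feasible s c) U a (d * (1 + a)) (output (feasible s c) U ρ υ q) := by
  have hn' : (0 : ℝ) < n := by exact_mod_cast hn
  have hK' : (0 : ℝ) < K := by exact_mod_cast hK
  have hS : 0 ≤ S := nonneg_of_mul_nonneg_left (le_trans (by positivity) hq) hK'
  have hZc := isCompact_feasible s c
  have hZne : (feasible s c).Nonempty := ⟨0, zero_mem_feasible hs c⟩
  have hU0 : ∀ i, ∀ x ∈ feasible s c, 0 ≤ U i x := fun i x hx => ((hU i).mem_Icc x hx).1
  set Z := feasible s c
  have hrun := isConsensusRun_iterate Z U ρ υ q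
  set x : ℕ → Fin n → Vec m := fun k => (iterate Z U ρ υ q k).x
  set z : ℕ → Vec m := fun k => (iterate Z U ρ υ q k).z
  set γ : ℕ → Fin n → Vec m := fun k => (iterate Z U ρ υ q k).γ
  have hmax : ∀ k i, x (k + 1) i ∈ Z ∧
      IsMaxOn (fun y => lagrangian ρ υ (U i) y (z k) (γ k i)) Z (x (k + 1) i) := fun k i =>
    argmaxOn_spec hZc hZne
      (continuousOn_lagrangian hυ (hU i).differentiable.continuousOn (hU0 i) _ _)
  have hxn : ∀ k i, ‖x (k + 1) i‖ ≤ 1 := fun k i => norm_le_one_of_mem_feasible (hmax k i).1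
  have hopt : ∀ k i, ∀ y ∈ Z, (U i y + υ) / (U i (x (k + 1) i) + υ) - 1 ≤
      inner ℝ (γ (k + 1) i + ρ • (z (k + 1) - z k)) (y - x (k + 1) i) := by
    intro k i y hy
    have h := div_sub_one_le_inner_of_isMaxOn hυ (hU i).concave (hU0 i) (hmax k i).1
      (hmax k i).2 hy
    have e : γ (k + 1) i + ρ • (z (k + 1) - z k) = γ k i + ρ • (x (k + 1) i - z k) := by
      rw [hrun.γ_succ k i]; module
    rwa [e]
  have hmean : ∀ k, (1 / (n : ℝ)) • ∑ i, x (k + 1) i ∈ Z := by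
    intro k
    rw [Finset.smul_sum]
    exact (convex_feasible s c).sum_mem (fun _ _ => by positivity) (by simp [hn'.ne'])
      fun i _ => (hmax k i).1
  have hB : ∑ k ∈ Finset.range K, ‖noiseAt q (k + 1)‖ ^ 2 ≤ S * K := by
    rwa [sum_noiseAt q fun v => ‖v‖ ^ 2]
  have hQ : ∑ k ∈ Finset.range K, ‖noiseAt q (k + 1)‖ ≤ √S * K := by
    have h := sq_sum_le_card_mul_sum_sq (s := Finset.range K) (f := fun k => ‖noiseAt q (k + 1)‖)
    rw [Finset.card_range] at h
    refine (sq_le_sq₀ (by positivity) (by positivity)).1 ?_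
    rw [mul_pow, Real.sq_sqrt hS]
    nlinarith
  have hqK : ‖noiseAt q K‖ ≤ √S * √K := by
    rw [← Real.sqrt_mul hS]
    refine Real.le_sqrt_of_sq_le (le_trans ?_ hB)
    have h := Finset.single_le_sum (f := fun k => ‖noiseAt q (k + 1)‖ ^ 2)
      (fun k _ => by positivity) (Finset.mem_range.2 (Nat.sub_lt hK one_pos))
    rwa [show K - 1 + 1 = K by omega] at h
  set xbar : Fin n → Vec m := fun i => (1 / (K : ℝ)) • ∑ k ∈ Finset.range K, x (k + 1) i
  set zbar : Vec m := (1 / (K : ℝ)) • ∑ k ∈ Finset.range K, z (k + 1) with hzbar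
  have hsumK : ∑ _k ∈ Finset.range K, 1 / (K : ℝ) = 1 := by simp [hK'.ne']
  have hxbar : ∀ i, xbar i ∈ Z := by
    intro i
    simp only [xbar]
    rw [Finset.smul_sum]
    exact (convex_feasible s c).sum_mem (fun _ _ => by positivity) hsumK fun k _ => (hmax k i).1
  have hout : output Z U ρ υ q = proj Z zbar := by
    rw [output, hzbar, Finset.range_eq_Ico, Finset.sum_Ico_add' z 0 K 1]
    congr 3
  have hsqrtK : √(K : ℝ) * √K = K := Real.mul_self_sqrt hK'.le
  have hsqrtKpos : 0 < √(K : ℝ) := Real.sqrt_pos.2 hK'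
  -- The time average of the means of the local variables is feasible, and `zbar` differs from it
  -- only by `q K / K`.
  have hdist1 : ‖zbar - proj Z zbar‖ ≤ √S / √K := by
    have hw : (1 / (K : ℝ)) • ∑ k ∈ Finset.range K, (1 / (n : ℝ)) • ∑ i, x (k + 1) i ∈ Z := by
      rw [Finset.smul_sum]
      exact (convex_feasible s c).sum_mem (fun _ _ => by positivity) hsumK fun k _ => hmean k
    refine (norm_sub_proj_le hZc zbar hw).trans ?_
    rw [hzbar, hrun.sum_z K, ← smul_sub, add_sub_cancel_left, norm_smul,
      Real.norm_of_nonneg (by positivity), one_div_mul_eq_div, div_le_div_iff₀ hK' hsqrtKpos]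
    refine (mul_le_mul_of_nonneg_right hqK hsqrtKpos.le).trans_eq ?_
    rw [mul_assoc, hsqrtK]
  have hdist2 : ∀ i, ‖xbar i - zbar‖ ≤
      √(4 * ρ + 32 * ρ ^ 2 + 22 * ρ ^ 2 * S) / ρ / √K := by
    intro i
    -- The lower bound `-1` holds since the utility ratio in the optimality condition is
    -- nonnegative.
    have h := hrun.norm_dual_sq_le hρ hxn i (fun k => by
      refine le_trans ?_ (hopt k i _ (hmean k))
      have := hU0 i _ (hmean k)
      have := hU0 i _ (hmax k i).1
      have : 0 ≤ (U i ((1 / (n : ℝ)) • ∑ i, x (k + 1) i) + υ) / (U i (x (k + 1) i) + υ) := by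
        positivity
      linarith) K
    have h2 : ‖γ K i‖ ≤ √(4 * ρ + 32 * ρ ^ 2 + 22 * ρ ^ 2 * S) * √K := by
      rw [← Real.sqrt_mul (by positivity)]
      refine Real.le_sqrt_of_sq_le (h.trans ?_)
      have := mul_le_mul_of_nonneg_left hB (show 0 ≤ 22 * ρ ^ 2 by positivity)
      linarith
    simp only [xbar]
    rw [hzbar, ← smul_sub, hrun.sum_x_sub_z hρ i K, norm_smul, norm_smul,
      Real.norm_of_nonneg (by positivity), Real.norm_of_nonneg (by positivity)]
    calc 1 / (K : ℝ) * (1 / ρ * ‖γ K i‖)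
        ≤ 1 / (K : ℝ) * (1 / ρ * (√(4 * ρ + 32 * ρ ^ 2 + 22 * ρ ^ 2 * S) * √K)) := by gcongr
      _ = √(4 * ρ + 32 * ρ ^ 2 + 22 * ρ ^ 2 * S) / ρ / √K := by
          rw [div_div, eq_div_iff (by positivity)]
          field_simp
          rw [sq, hsqrtK]
  have hproj : proj Z zbar ∈ Z := (proj_spec hZc hZne zbar).1
  rw [hout]
  refine isApproxCore_of_sum_div_le (υ := υ) (b := fun i => U i (xbar i) + υ) hn hproj hU0 hυ
    (le_trans (by positivity) ha) (fun i => ?_) (fun i => ?_) fun y hy => ?_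
  · have := hU0 i _ (hxbar i)
    positivity
  · have h1 := (abs_le.1 (hLip i _ (hxbar i) _ hproj)).2
    have h2 : ∑ j, |xbar i j - proj Z zbar j| ≤ √m * ‖xbar i - proj Z zbar‖ :=
      sum_abs_le_sqrt_mul_norm (xbar i - proj Z zbar)
    have h3 : ‖xbar i - proj Z zbar‖ ≤
        (√(4 * ρ + 32 * ρ ^ 2 + 22 * ρ ^ 2 * S) / ρ + √S) / √K := by
      rw [add_div]
      exact (norm_sub_le_norm_sub_add_norm_sub _ zbar _).trans (add_le_add (hdist2 i) hdist1)
    have h4 : L * ∑ j, |xbar i j - proj Z zbar j| ≤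
        L * (√m / √K) * (√(4 * ρ + 32 * ρ ^ 2 + 22 * ρ ^ 2 * S) / ρ + √S) := by
      rw [mul_assoc]
      refine mul_le_mul_of_nonneg_left (h2.trans ?_) hL
      rw [div_mul_eq_mul_div, mul_div_assoc]
      exact mul_le_mul_of_nonneg_left h3 (by positivity)
    linarith
  · have hJ : ∀ i, K * ((U i y + υ) / (U i (xbar i) + υ)) ≤
        ∑ k ∈ Finset.range K, (U i y + υ) / (U i (x (k + 1) i) + υ) := fun i =>
      div_le_sum_div (V := fun w => U i w + υ) (x := fun k => x (k + 1) i)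
        ((hU i).concave.add_const υ)
        (fun w hw => by have := hU0 i w hw; positivity) hK (fun k => (hmax k i).1)
        (by have := hU0 i y hy; positivity)
    have h1 := Finset.sum_le_sum fun i (_ : i ∈ Finset.univ) => hJ i
    rw [← Finset.mul_sum, Finset.sum_comm] at h1
    have h2 := hrun.sum_sum_inner_gap_le hn hρ (norm_le_one_of_mem_feasible hy) hxn K
    have h3 := Finset.sum_le_sum fun k (_ : k ∈ Finset.range K) =>
      Finset.sum_le_sum fun i (_ : i ∈ Finset.univ) => hopt k i y hy
    simp only [Finset.sum_sub_distrib, Finset.sum_const, Finset.card_univ, Fintype.card_fin,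
      Finset.card_range, nsmul_eq_mul, mul_one] at h3
    have h4 : n * ρ * (1 / 2 + 2 * ∑ k ∈ Finset.range K, ‖noiseAt q (k + 1)‖ +
        5 * ∑ k ∈ Finset.range K, ‖noiseAt q (k + 1)‖ ^ 2) ≤ K * (n * a) := by
      calc _ ≤ n * ρ * (1 / 2 + 2 * (√S * K) + 5 * (S * K)) := by gcongr
        _ = K * (n * (ρ * (1 / (2 * K) + 2 * √S + 5 * S))) := by field_simp
        _ ≤ _ := by gcongr
    refine le_of_mul_le_mul_left ?_ hK'
    linarith

/-- Here `D` stands for `m log (1/δ) / (nε²)`. For `D ≤ 1` both error terms are `O(√D)`, and `√D ≤ D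
^ (1/4)`. -/
theorem isApproxCore_output_of_sum_le {K : ℕ} {s : Fin m → ℝ} {c ρ β L υ c₁ c₃ κ cS D : ℝ}
    {U : Fin n → Vec m → ℝ} (hn : 0 < n) (hK : 0 < K) (hm : 0 < m) (hs : ∀ j, 0 < s j)
    (hρ : 0 < ρ) (hυ : 0 < υ) (hU : ∀ i, IsUtility (feasible s c) β (U i))
    (hLip : ∀ i, ∀ x ∈ feasible s c, ∀ y ∈ feasible s c,
      |U i x - U i y| ≤ L * ∑ j, |x j - y j|)
    (hc₁ : 0 < c₁) (hc₃ : 0 < c₃) (hκ : 0 < κ) (hcS : 0 < cS) (hD : 0 < D)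
    (hKlb : (n : ℝ) ≤ c₁ * K) (hυub : υ ≤ c₃ * (1 / √n)) (hmD : (m : ℝ) / n ≤ κ * D)
    (q : Fin K → Vec m) (hq : ∑ k, ‖q k‖ ^ 2 ≤ cS * D * K) :
    IsApproxCore (feasible s c) U (ρ * (c₁ * κ + 2 * √cS + 5 * cS) * √D)
      ((1 + c₃ * √κ + |L| * √(c₁ * κ) *
        (√(4 * ρ + 32 * ρ ^ 2 + 22 * ρ ^ 2 * cS) / ρ + √cS)) * D ^ (1 / 4 : ℝ) *
        (1 + ρ * (c₁ * κ + 2 * √cS + 5 * cS) * √D))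
      (output (feasible s c) U ρ υ q) := by
  have hn' : (0 : ℝ) < n := by exact_mod_cast hn
  have hK' : (0 : ℝ) < K := by exact_mod_cast hK
  have hm' : (0 : ℝ) < m := by exact_mod_cast hm
  have hm1 : (1 : ℝ) ≤ m := by exact_mod_cast hm
  have h1D : 1 / (n : ℝ) ≤ κ * D := le_trans (by gcongr) hmD
  have hε₁ : 0 ≤ ρ * (c₁ * κ + 2 * √cS + 5 * cS) * √D := by positivity
  set r := √(4 * ρ + 32 * ρ ^ 2 + 22 * ρ ^ 2 * cS) / ρ + √cS with hr
  have hrpos : 0 ≤ r := by positivity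
  -- For `D ≥ 1` the summand `1` in the second constant makes the additive slack at least 1, and
  -- utilities in `[0, 1]` cannot violate it.
  rcases le_total 1 D with hD1 | hD1
  · refine isApproxCore_of_one_le (proj_spec (isCompact_feasible s c)
      ⟨0, zero_mem_feasible hs c⟩ _).1 (fun i => (hU i).mem_Icc) hε₁ ?_
    have h1 : 1 ≤ D ^ (1 / 4 : ℝ) := Real.one_le_rpow hD1 (by norm_num)
    have h2 : 1 ≤ (1 + c₃ * √κ + |L| * √(c₁ * κ) * r) * D ^ (1 / 4 : ℝ) := by
      refine one_le_mul_of_one_le_of_one_le ?_ h1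
      have : 0 ≤ c₃ * √κ := by positivity
      have : 0 ≤ |L| * √(c₁ * κ) * r := by positivity
      linarith
    exact one_le_mul_of_one_le_of_one_le h2 (by linarith)
  have hsq : D ≤ √D := Real.le_sqrt_of_sq_le (by nlinarith)
  have hquart : √D ≤ D ^ (1 / 4 : ℝ) := by
    rw [Real.sqrt_eq_rpow]
    exact Real.rpow_le_rpow_of_exponent_ge hD hD1 (by norm_num)
  have hKinv : 1 / (K : ℝ) ≤ c₁ * (1 / n) := by
    rw [mul_one_div, div_le_div_iff₀ hK' hn', one_mul]
    exact hKlb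
  refine isApproxCore_output (L := |L|) (S := cS * D) hn hK hs hρ (abs_nonneg L) hυ hU
    (fun i x hx y hy => (hLip i x hx y hy).trans ?_) q hq ?_ ?_
  · exact mul_le_mul_of_nonneg_right (le_abs_self L) (by positivity)
  · have h1 : 1 / (2 * K : ℝ) ≤ c₁ * κ * √D := by
      calc 1 / (2 * K : ℝ) ≤ 1 / (K : ℝ) := by gcongr; linarith
        _ ≤ c₁ * (κ * D) := hKinv.trans (by gcongr)
        _ ≤ c₁ * κ * √D := by rw [mul_assoc]; gcongr
    calc ρ * (1 / (2 * K) + 2 * √(cS * D) + 5 * (cS * D))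
        ≤ ρ * (c₁ * κ * √D + 2 * (√cS * √D) + 5 * (cS * √D)) := by
          rw [Real.sqrt_mul hcS.le]; gcongr
      _ = _ := by ring
  · have h1 : υ ≤ c₃ * √κ * √D := by
      refine hυub.trans ?_
      rw [mul_assoc, ← Real.sqrt_mul hκ.le, ← Real.sqrt_one, ← Real.sqrt_div zero_le_one]
      gcongr
    have h2 : √(m : ℝ) / √(K : ℝ) ≤ √(c₁ * κ) * √D := by
      rw [← Real.sqrt_mul (by positivity), ← Real.sqrt_div hm'.le]
      refine Real.sqrt_le_sqrt ?_
      calc (m : ℝ) / K = m * (1 / K) := by ring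
        _ ≤ m * (c₁ * (1 / n)) := by gcongr
        _ = c₁ * (m / n) := by ring
        _ ≤ c₁ * (κ * D) := by gcongr
        _ = _ := by ring
    have h3 : √(4 * ρ + 32 * ρ ^ 2 + 22 * ρ ^ 2 * (cS * D)) / ρ + √(cS * D) ≤ r := by
      have : cS * D ≤ cS := mul_le_of_le_one_right hcS.le hD1
      exact add_le_add (div_le_div_of_nonneg_right (Real.sqrt_le_sqrt (by gcongr)) hρ.le)
        (Real.sqrt_le_sqrt this)
    calc υ + |L| * (√(m : ℝ) / √(K : ℝ)) *
          (√(4 * ρ + 32 * ρ ^ 2 + 22 * ρ ^ 2 * (cS * D)) / ρ + √(cS * D))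
        ≤ c₃ * √κ * √D + |L| * (√(c₁ * κ) * √D) * r := by gcongr
      _ = (c₃ * √κ + |L| * √(c₁ * κ) * r) * √D := by ring
      _ ≤ (1 + c₃ * √κ + |L| * √(c₁ * κ) * r) * D ^ (1 / 4 : ℝ) := by
          gcongr
          linarith

theorem noiseVariance_eq {K : ℕ} {ε δ : ℝ} (hε : 0 < ε) (hδ : 0 < Real.log (1 / δ)) :
    noiseVariance n K ε δ (2 * Real.log (1 / δ) / ε + 1) =
      2 * K * (2 * Real.log (1 / δ) / ε + 1) / (n ^ 2 * ε) := by
  have h : iterationPrivacy K ε δ (2 * Real.log (1 / δ) / ε + 1) = ε / (2 * K) := by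
    rw [iterationPrivacy, add_sub_cancel_right]
    field_simp
    ring
  rw [noiseVariance, h]
  simp only [div_eq_mul_inv, mul_inv_rev, inv_inv]
  ring

end PPGA

/-! ### Choice of constants and the probability bound. -/

theorem mainTheorem4
    (ρ β L κ : ℝ) (hρ : 0 < ρ)
    (m K : ℕ → ℕ) (υ : ℕ → ℝ)
    (hm : (fun n => (m n : ℝ)) =o[atTop] fun n : ℕ => √(n : ℝ))
    (hK : (fun n => (K n : ℝ)) =Θ[atTop] fun n : ℕ => (n : ℝ))
    (hυ : υ =Θ[atTop] fun n : ℕ => 1 / √(n : ℝ))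
    (hυ01 : ∀ᶠ n in atTop, υ n ∈ Set.Ioo (0 : ℝ) 1) :
    ∃ C₁ C₂ : ℝ, 0 < C₁ ∧ 0 < C₂ ∧ ∀ᶠ n : ℕ in atTop,
      ∀ (s : Fin (m n) → ℝ) (c : ℝ) (U : Fin n → PPGA.Vec (m n) → ℝ) (ε δ : ℝ),
        (∀ j, 0 < s j) → 0 < c →
        (∀ i, PPGA.IsUtility (PPGA.feasible s c) β (U i)) →
        (∀ i, ∀ x ∈ PPGA.feasible s c, ∀ y ∈ PPGA.feasible s c,
          |U i x - U i y| ≤ L * ∑ j, |x j - y j|) →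
        ε ∈ Set.Ioo (0 : ℝ) 1 → δ ∈ Set.Ioo (0 : ℝ) 1 → ε ≤ κ * Real.log (1 / δ) →
        let α : ℝ := 2 * Real.log (1 / δ) / ε + 1
        let ε₁ : ℝ := C₁ * √((m n : ℝ) * Real.log (1 / δ) / (n * ε ^ 2))
        let ε₂ : ℝ := C₂ * ((m n : ℝ) * Real.log (1 / δ) / (n * ε ^ 2)) ^ (1 / 4 : ℝ)
        1 - 1 / (n : ℝ) - 1 / (n : ℝ) ^ (m n) ≤
          (PPGA.noiseLaw n (m n) (K n) ε δ α).real
            {q | PPGA.IsApproxCore (PPGA.feasible s c) U ε₁ (ε₂ * (1 + ε₁))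
              (PPGA.output (PPGA.feasible s c) U ρ (υ n) q)} := by
  obtain ⟨c₂, hc₂, hKub⟩ := hK.isBigO.exists_pos
  obtain ⟨c₁, hc₁, hKlb⟩ := hK.isBigO_symm.exists_pos
  obtain ⟨c₃, hc₃, hυub⟩ := hυ.isBigO.exists_pos
  -- The sign of `κ` is not given, while the constants must be positive.
  set κ' := max κ 1
  have hκ'pos : 0 < κ' := lt_of_lt_of_le one_pos (le_max_right _ _)
  -- Obtained from `4 σ² (1 + c₁) m` with `K ≤ c₂ n` and `2l/ε + 1 ≤ (2 + κ') l/ε`; see `hvD`.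
  set cS := 8 * (1 + c₁) * c₂ * (2 + κ') with hcS
  have hcSpos : 0 < cS := by positivity
  refine ⟨ρ * (c₁ * κ' + 2 * √cS + 5 * cS), 1 + c₃ * √κ' + |L| * √(c₁ * κ') *
    (√(4 * ρ + 32 * ρ ^ 2 + 22 * ρ ^ 2 * cS) / ρ + √cS), by positivity, by positivity, ?_⟩
  filter_upwards [hKub.bound, hKlb.bound, hυub.bound, hυ01, eventually_gt_atTop 0] with n hKub hKlb
    hυub hυ01 hn s c U ε δ hs hc hU hLip hε hδ hεδ
  intro α ε₁ ε₂
  have hn' : (0 : ℝ) < n := by exact_mod_cast hn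
  -- For `m = 0` the term `1 / n ^ 0 = 1` makes the claimed probability nonpositive.
  rcases Nat.eq_zero_or_pos (m n) with hm0 | hm0
  · refine le_trans ?_ measureReal_nonneg
    rw [hm0, pow_zero]
    have : 0 ≤ 1 / (n : ℝ) := by positivity
    linarith
  simp only [Real.norm_eq_abs, Nat.abs_cast, abs_div, abs_one, abs_of_nonneg (Real.sqrt_nonneg _),
    abs_of_pos hυ01.1] at hKub hKlb hυub
  have hK' : (0 : ℝ) < K n := pos_of_mul_pos_right (hn'.trans_le hKlb) hc₁.le
  have hKpos : 0 < K n := by exact_mod_cast hK'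
  have hm1 : (1 : ℝ) ≤ m n := by exact_mod_cast hm0
  have hm' : (0 : ℝ) < m n := by exact_mod_cast hm0
  set l := Real.log (1 / δ) with hl
  have hlpos : 0 < l := Real.log_pos (by rw [lt_div_iff₀ hδ.1]; linarith [hδ.2])
  have hεl : ε ≤ κ' * l := hεδ.trans (mul_le_mul_of_nonneg_right (le_max_left _ _) hlpos.le)
  have hε0 := hε.1
  set D := (m n : ℝ) * l / (n * ε ^ 2) with hD
  have hDpos : 0 < D := by positivity
  have hmD : (m n : ℝ) / n ≤ κ' * D := by
    have h1 : ε ^ 2 ≤ κ' * l := le_trans (by nlinarith [hε.2]) hεl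
    rw [hD, mul_div_assoc', div_le_div_iff₀ hn' (by positivity)]
    calc (m n : ℝ) * (n * ε ^ 2) ≤ m n * (n * (κ' * l)) := by gcongr
      _ = _ := by ring
  have hvar : PPGA.noiseVariance n (K n) ε δ α = 2 * K n * (2 * l / ε + 1) / (n ^ 2 * ε) :=
    PPGA.noiseVariance_eq hε0 hlpos
  have hvpos : 0 < PPGA.noiseVariance n (K n) ε δ α := by
    rw [hvar]; positivity
  have hvD : 4 * PPGA.noiseVariance n (K n) ε δ α * (1 + c₁) * m n ≤ cS * D := by
    have h1 : 2 * l / ε + 1 ≤ (2 + κ') * l / ε := by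
      rw [add_mul, add_div, add_le_add_iff_left, le_div_iff₀ hε0, one_mul]
      exact hεl
    rw [hvar, hcS, hD]
    calc 4 * (2 * K n * (2 * l / ε + 1) / (n ^ 2 * ε)) * (1 + c₁) * m n
        ≤ 4 * (2 * (c₂ * n) * ((2 + κ') * l / ε) / (n ^ 2 * ε)) * (1 + c₁) * m n := by gcongr
      _ = _ := by field_simp; ring
  -- With `τ = 1 + c₁` the failure exponent is `c₁ m K ≥ n`, because `n ≤ c₁ K`; hence the failure
  -- probability is at most `exp (-n) ≤ 1 / n`.
  have hprob := measureReal_sum_norm_sq_lt_ge (m := m n) (K := K n) hvpos (1 + c₁)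
  have hexp : Real.exp (-((m n * K n : ℕ) * (1 + c₁ - 1))) ≤ 1 / n := by
    have h1 : (n : ℝ) ≤ (m n * K n : ℕ) * (1 + c₁ - 1) := by
      rw [add_sub_cancel_left, Nat.cast_mul]
      nlinarith [mul_pos hc₁ hK']
    rw [Real.exp_neg, one_div]
    gcongr
    linarith [Real.add_one_le_exp ((m n * K n : ℕ) * (1 + c₁ - 1))]
  have hpow : 0 ≤ 1 / (n : ℝ) ^ m n := by positivity
  refine le_trans (by linarith) (hprob.trans ?_)
  refine measureReal_mono (fun q hq => ?_) (measure_ne_top _ _)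
  change ∑ k, ‖q k‖ ^ 2 < _ at hq
  change PPGA.IsApproxCore _ _ _ _ _
  have hq' : ∑ k, ‖q k‖ ^ 2 ≤ cS * D * K n := by
    refine hq.le.trans ?_
    rw [Nat.cast_mul, ← mul_assoc]
    exact mul_le_mul_of_nonneg_right hvD hK'.le
  exact PPGA.isApproxCore_output_of_sum_le hn hKpos hm0 hs hρ hυ01.1 hU hLip hc₁ hc₃ hκ'pos hcSpos
    hDpos hKlb hυub hmD q hq'
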